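/- Let $A$ be a (not necessarily unital) C*-algebra and let $\mathcal U$ be a non-principal ultrafilter on $\mathbb N$. Let $A^{\mathcal U}=\ell^\infty(A)/c_{\mathcal U}(A)$ be the C*-algebra ultrapower, where $\ell^\infty(A)$ is the C*-algebra of bounded sequences in $A$ and $c_{\mathcal U}(A)=\{(a_n)\in\ell^\infty(A):\lim_{n\to\mathcal U}\|a_n\|=0\}$; write $(a_n)^{\mathcal U}$ for the class of $(a_n)$. A trace on a C*-algebra is a bounded positive linear functional $\tau$ with $\tau(ab)=\tau(ba)$ for all $a,b$; a tracial state is a trace of norm $1$; an extremal tracial state is an extreme point of the convex set of tracial states. A functional $\tau$ on $A^{\mathcal U}$ is the $\mathcal U$-limit of a sequence $(\sigma_n)$ of functionals on $A$ if $\tau((a_n)^{\mathcal U})=\lim_{n\to\mathcal U}\sigma_n(a_n)$ for all $(a_n)\in\ell^\infty(A)$. If $A$ has infinitely many extremal tracial states, then there is a trace on $A^{\mathcal U}$, which can be taken to be a tracial state, that is not the $\mathcal U$-limit of any sequence of traces on $A$. -/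

import Mathlib

open Filter Topology
open scoped ENNReal ComplexOrder

noncomputable section

/-! ### The ultrapower of a C⋆-algebra -/

namespace CStarUltrapower

variable (U : Ultrafilter ℕ) (A : Type*) [NonUnitalCStarAlgebra A]

/-- `c_U(A)`: the bounded sequences in `A` whose norms tend to `0` along `U`, as a subspace of
`ℓ^∞(A)`. -/
def nullSeq : Submodule ℂ (lp (fun _ : ℕ => A) ∞) where
  carrier := {a | Tendsto (fun n => ‖a n‖) U (𝓝 0)}
  zero_mem' := by simp
  add_mem' := by
    intro a b ha hb
    have h := Tendsto.add ha hb
    rw [add_zero] at h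
    exact squeeze_zero (fun n => norm_nonneg _) (fun n => norm_add_le (a n) (b n)) h
  smul_mem' := by
    intro c a ha
    have h := Tendsto.const_mul ‖c‖ ha
    rw [mul_zero] at h
    exact squeeze_zero (fun n => norm_nonneg _) (fun n => (norm_smul_le c (a n))) h

variable {U A}

theorem mem_nullSeq {a : lp (fun _ : ℕ => A) ∞} :
    a ∈ nullSeq U A ↔ Tendsto (fun n => ‖a n‖) U (𝓝 0) := Iff.rfl

theorem norm_coe_le (a : lp (fun _ : ℕ => A) ∞) (n : ℕ) : ‖a n‖ ≤ ‖a‖ :=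
  lp.norm_apply_le_norm ENNReal.top_ne_zero a n

theorem mul_mem_left (a : lp (fun _ : ℕ => A) ∞) {b : lp (fun _ : ℕ => A) ∞}
    (hb : b ∈ nullSeq U A) : a * b ∈ nullSeq U A := by
  have h := Tendsto.const_mul ‖a‖ (mem_nullSeq.1 hb)
  rw [mul_zero] at h
  refine squeeze_zero (fun n => norm_nonneg _) (fun n => ?_) h
  exact (norm_mul_le (a n) (b n)).trans
    (mul_le_mul_of_nonneg_right (norm_coe_le a n) (norm_nonneg _))

theorem mul_mem_right (b : lp (fun _ : ℕ => A) ∞) {a : lp (fun _ : ℕ => A) ∞}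
    (ha : a ∈ nullSeq U A) : a * b ∈ nullSeq U A := by
  have h := Tendsto.mul_const ‖b‖ (mem_nullSeq.1 ha)
  rw [zero_mul] at h
  refine squeeze_zero (fun n => norm_nonneg _) (fun n => ?_) h
  exact (norm_mul_le (a n) (b n)).trans
    (mul_le_mul_of_nonneg_left (norm_coe_le b n) (norm_nonneg _))

theorem star_mem {a : lp (fun _ : ℕ => A) ∞}
    (ha : a ∈ nullSeq U A) : star a ∈ nullSeq U A := by
  refine (mem_nullSeq.1 ha).congr (fun n => ?_)
  rw [lp.star_apply, norm_star]

instance isClosed_nullSeq : IsClosed (nullSeq U A : Set (lp (fun _ : ℕ => A) ∞)) := by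
  refine isClosed_of_closure_subset fun a ha => ?_
  refine mem_nullSeq.2 (Metric.tendsto_nhds.2 fun ε hε => ?_)
  obtain ⟨b, hb, hab⟩ := Metric.mem_closure_iff.1 ha (ε / 2) (half_pos hε)
  filter_upwards [Metric.tendsto_nhds.1 (mem_nullSeq.1 hb) (ε / 2) (half_pos hε)] with n hn
  simp only [dist_zero_right, norm_norm] at hn ⊢
  rw [dist_eq_norm] at hab
  have h1 : ‖a n - b n‖ ≤ ‖a - b‖ := norm_coe_le (a - b) n
  have h2 : ‖a n‖ ≤ ‖a n - b n‖ + ‖b n‖ := by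
    simpa using norm_add_le (a n - b n) (b n)
  linarith

end CStarUltrapower

/-- The ultrapower `A^U = ℓ^∞(A) / c_U(A)`. -/
def CStarUltrapower (U : Ultrafilter ℕ) (A : Type*) [NonUnitalCStarAlgebra A] : Type _ :=
  lp (fun _ : ℕ => A) ∞ ⧸ CStarUltrapower.nullSeq U A

namespace CStarUltrapower

variable {U : Ultrafilter ℕ} {A : Type*} [NonUnitalCStarAlgebra A]

/-- The quotient norm. -/
instance : NormedAddCommGroup (CStarUltrapower U A) :=
  inferInstanceAs (NormedAddCommGroup (lp (fun _ : ℕ => A) ∞ ⧸ nullSeq U A))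

instance : NormedSpace ℂ (CStarUltrapower U A) :=
  inferInstanceAs (NormedSpace ℂ (lp (fun _ : ℕ => A) ∞ ⧸ nullSeq U A))

instance : CompleteSpace (CStarUltrapower U A) :=
  inferInstanceAs (CompleteSpace (lp (fun _ : ℕ => A) ∞ ⧸ nullSeq U A))

/-- The quotient map `ℓ^∞(A) → A^U`. -/
def mk (U : Ultrafilter ℕ) (A : Type*) [NonUnitalCStarAlgebra A] :
    lp (fun _ : ℕ => A) ∞ →ₗ[ℂ] CStarUltrapower U A :=
  (nullSeq U A).mkQ

theorem mk_surjective (x : CStarUltrapower U A) : ∃ a, mk U A a = x :=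
  Submodule.mkQ_surjective (nullSeq U A) x

theorem mk_eq_mk {a b : lp (fun _ : ℕ => A) ∞} : mk U A a = mk U A b ↔ a - b ∈ nullSeq U A :=
  Submodule.Quotient.eq (nullSeq U A)

instance : Mul (CStarUltrapower U A) where
  mul := Quotient.map₂ (· * ·) (by
    intro a a' ha b b' hb
    have ha' := (Submodule.quotientRel_def (nullSeq U A)).1 ha
    have hb' := (Submodule.quotientRel_def (nullSeq U A)).1 hb
    refine (Submodule.quotientRel_def (nullSeq U A)).2 ?_
    have h : a * b - a' * b' = (a - a') * b + a' * (b - b') := by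
      rw [sub_mul, mul_sub]; abel
    simp only [h]
    exact add_mem (mul_mem_right b ha') (mul_mem_left a' hb'))

instance : Star (CStarUltrapower U A) where
  star := Quotient.map star (by
    intro a a' ha
    have ha' := (Submodule.quotientRel_def (nullSeq U A)).1 ha
    refine (Submodule.quotientRel_def (nullSeq U A)).2 ?_
    rw [← star_sub]
    exact star_mem ha')

theorem mk_mul (a b : lp (fun _ : ℕ => A) ∞) : mk U A (a * b) = mk U A a * mk U A b := rfl

theorem mk_star (a : lp (fun _ : ℕ => A) ∞) : mk U A (star a) = star (mk U A a) := rfl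

/-- The quotient norm of the class of `(a_n)` is `lim_{n → U} ‖a_n‖`. -/
theorem tendsto_norm (a : lp (fun _ : ℕ => A) ∞) :
    Tendsto (fun n => ‖a n‖) U (𝓝 ‖mk U A a‖) := by
  obtain ⟨L, -, hL⟩ := isCompact_Icc.ultrafilter_le_nhds
    (U.map fun n => ‖a n‖) (s := Set.Icc 0 ‖a‖)
    (by
      simp only [le_principal_iff, Ultrafilter.mem_coe, Ultrafilter.mem_map]
      exact Filter.univ_mem' fun n => ⟨norm_nonneg _, norm_coe_le a n⟩)
  have hL' : Tendsto (fun n => ‖a n‖) U (𝓝 L) := hL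
  suffices h : ‖mk U A a‖ = L by rwa [h]
  apply le_antisymm
  · refine le_of_forall_gt_imp_ge_of_dense fun c hc => ?_
    have hc0 : 0 ≤ c :=
      (ge_of_tendsto hL' (Filter.Eventually.of_forall fun n => norm_nonneg _)).trans hc.le
    classical
    let f : ℕ → A := fun n => if ‖a n‖ ≤ c then a n else 0
    have hf : ∀ n, ‖f n‖ ≤ c := by
      intro n
      by_cases h : ‖a n‖ ≤ c
      · simp [f, h]
      · simpa [f, h] using hc0
    let b : lp (fun _ : ℕ => A) ∞ :=
      ⟨f, memℓp_infty ⟨c, by rintro _ ⟨n, rfl⟩; exact hf n⟩⟩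
    have hab : mk U A a = mk U A b := by
      refine mk_eq_mk.2 (mem_nullSeq.2 ?_)
      refine Tendsto.congr' ?_ tendsto_const_nhds
      filter_upwards [hL'.eventually (gt_mem_nhds hc)] with n hn
      have : b n = a n := by
        change f n = a n
        simp [f, hn.le]
      change 0 = ‖a n - b n‖
      rw [this, sub_self, norm_zero]
    rw [hab]
    exact (Submodule.Quotient.norm_mk_le (nullSeq U A) b).trans
      (lp.norm_le_of_forall_le hc0 hf)
  · refine le_of_forall_pos_le_add fun ε hε => ?_
    obtain ⟨b, hb, hbn⟩ := Submodule.Quotient.norm_mk_lt (S := nullSeq U A) (mk U A a) hε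
    have hba : mk U A b = mk U A a := hb
    have hlim := (mem_nullSeq.1 (mk_eq_mk.1 hba)).add_const (‖mk U A a‖ + ε)
    rw [zero_add] at hlim
    refine le_of_tendsto_of_tendsto hL' hlim ?_
    refine Filter.Eventually.of_forall fun n => ?_
    change ‖a n‖ ≤ ‖b n - a n‖ + (‖mk U A a‖ + ε)
    have h1 := norm_coe_le b n
    have h2 : ‖a n‖ ≤ ‖b n - a n‖ + ‖b n‖ := by
      have := norm_sub_norm_le (a n) (b n)
      rw [norm_sub_rev] at this
      linarith
    have h3 : ‖b‖ < ‖mk U A a‖ + ε := hbn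
    linarith

instance : NonUnitalNormedRing (CStarUltrapower U A) where
  __ := (inferInstance : NormedAddCommGroup (CStarUltrapower U A))
  left_distrib x y z := by
    obtain ⟨a, rfl⟩ := mk_surjective x
    obtain ⟨b, rfl⟩ := mk_surjective y
    obtain ⟨c, rfl⟩ := mk_surjective z
    simp only [← map_add, ← mk_mul, mul_add]
  right_distrib x y z := by
    obtain ⟨a, rfl⟩ := mk_surjective x
    obtain ⟨b, rfl⟩ := mk_surjective y
    obtain ⟨c, rfl⟩ := mk_surjective z
    simp only [← map_add, ← mk_mul, add_mul]
  zero_mul x := by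
    obtain ⟨a, rfl⟩ := mk_surjective x
    rw [← map_zero (mk U A), ← mk_mul, zero_mul]
  mul_zero x := by
    obtain ⟨a, rfl⟩ := mk_surjective x
    rw [← map_zero (mk U A), ← mk_mul, mul_zero]
  mul_assoc x y z := by
    obtain ⟨a, rfl⟩ := mk_surjective x
    obtain ⟨b, rfl⟩ := mk_surjective y
    obtain ⟨c, rfl⟩ := mk_surjective z
    simp only [← mk_mul, mul_assoc]
  norm_mul_le x y := by
    obtain ⟨a, rfl⟩ := mk_surjective x
    obtain ⟨b, rfl⟩ := mk_surjective y
    rw [← mk_mul]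
    exact le_of_tendsto_of_tendsto (tendsto_norm (a * b))
      ((tendsto_norm a).mul (tendsto_norm b))
      (Filter.Eventually.of_forall fun n => norm_mul_le (a n) (b n))

instance : StarRing (CStarUltrapower U A) where
  star_involutive x := by
    obtain ⟨a, rfl⟩ := mk_surjective x
    rw [← mk_star, ← mk_star, star_star]
  star_mul x y := by
    obtain ⟨a, rfl⟩ := mk_surjective x
    obtain ⟨b, rfl⟩ := mk_surjective y
    simp only [← mk_star, ← mk_mul, star_mul]
  star_add x y := by
    obtain ⟨a, rfl⟩ := mk_surjective x
    obtain ⟨b, rfl⟩ := mk_surjective y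
    simp only [← mk_star, ← map_add, star_add]

/-- The ultrapower of a C⋆-algebra is a C⋆-algebra. -/
instance : NonUnitalCStarAlgebra (CStarUltrapower U A) where
  norm_mul_self_le x := by
    obtain ⟨a, rfl⟩ := mk_surjective x
    rw [← mk_star, ← mk_mul]
    exact le_of_tendsto_of_tendsto ((tendsto_norm a).mul (tendsto_norm a))
      (tendsto_norm (star a * a))
      (Filter.Eventually.of_forall fun n => CStarRing.norm_mul_self_le (a n))
  smul_assoc r x y := by
    obtain ⟨a, rfl⟩ := mk_surjective x
    obtain ⟨b, rfl⟩ := mk_surjective y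
    simp only [smul_eq_mul, ← map_smul, ← mk_mul, smul_mul_assoc]
  smul_comm r x y := by
    obtain ⟨a, rfl⟩ := mk_surjective x
    obtain ⟨b, rfl⟩ := mk_surjective y
    simp only [smul_eq_mul, ← map_smul, ← mk_mul, mul_smul_comm]
  star_smul r x := by
    obtain ⟨a, rfl⟩ := mk_surjective x
    simp only [← mk_star, ← map_smul, star_smul]

end CStarUltrapower

/-! ### Traces -/

/-- A trace on a C⋆-algebra: a (bounded) positive linear functional `φ` with
`φ (a * b) = φ (b * a)`. -/
structure IsTrace {B : Type*} [NonUnitalCStarAlgebra B] (φ : B →L[ℂ] ℂ) : Prop where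
  nonneg : ∀ a : B, 0 ≤ φ (star a * a)
  map_mul_comm : ∀ a b : B, φ (a * b) = φ (b * a)

/-- The set of tracial states: the traces of norm one. -/
def tracialStates (B : Type*) [NonUnitalCStarAlgebra B] : Set (B →L[ℂ] ℂ) :=
  {φ | IsTrace φ ∧ ‖φ‖ = 1}

/-- The extremal tracial states: the extreme points of the convex set of tracial states. -/
def extremalTracialStates (B : Type*) [NonUnitalCStarAlgebra B] : Set (B →L[ℂ] ℂ) :=
  (tracialStates B).extremePoints ℝ

/-- `τ` is the `U`-limit of the functionals `σ n`: `τ ((a_n)^U) = lim_{n → U} σ_n (a_n)` for every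
bounded sequence `(a_n)`. -/
def IsUltralimit {A : Type*} [NonUnitalCStarAlgebra A] (U : Ultrafilter ℕ)
    (σ : ℕ → A →L[ℂ] ℂ) (τ : CStarUltrapower U A →L[ℂ] ℂ) : Prop :=
  ∀ a : lp (fun _ : ℕ => A) ∞,
    Tendsto (fun n => σ n (a n)) U (𝓝 (τ (CStarUltrapower.mk U A a)))

end

/-! ### Basic properties of traces -/

namespace IsTrace

variable {B : Type*} [NonUnitalCStarAlgebra B] {φ ψ : B →L[ℂ] ℂ}

/-! Take distinct extremal tracial states `φ j`, let `ψ` be their pointwise limit along `U`, let `Φ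
j` be the ultralimit of the constant sequence `φ j`, and let `τ` be the limit of the `Φ j`. On
constant sequences `τ` agrees with `ψ`, so if `τ` were the ultralimit of `(σ n)`, then `σ n → ψ`
pointwise along `U`. Suppose contractions `e k` satisfy `ψ (e k) ≤ α < β ≤ φ j (e k)` for all `j ≤
k`, apart from one index `i`. A diagonal choice `k n → ∞` keeps `σ n (e (k n))` below some `γ < β`,
while every `Φ j` with `j ≠ i`, hence `τ`, is at least `β` on the class of `(e (k n))`: a
contradiction (`not_isUltralimit_of_separated`).

The `e k` exist because distinct extremal tracial states are mutually singular. If every `φ j` is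
singular to `ψ`, separate finitely many of them from `ψ`; otherwise `ψ` dominates a multiple of some
`φ i`, and separating the others from `φ i` suffices (`exists_separating_limit`).

Separation of singular traces is a Radon–Nikodym argument inside the algebra: almost minimizing `(φ
+ ψ) (a²) - 2 φ a` yields approximate densities of `φ`, asymptotically central in the 2-norm. They
produce a common minorant of `φ` and `ψ`, whose vanishing makes them behave like a projection
supporting `φ` and killing `ψ`. -/

theorem add (hφ : IsTrace φ) (hψ : IsTrace ψ) : IsTrace (φ + ψ) where
  nonneg a := by simpa using add_nonneg (hφ.nonneg a) (hψ.nonneg a)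
  map_mul_comm a b := by simp [hφ.map_mul_comm a b, hψ.map_mul_comm a b]

theorem smul (hφ : IsTrace φ) {c : ℝ} (hc : 0 ≤ c) : IsTrace (c • φ) where
  nonneg a := by simpa using smul_nonneg hc (hφ.nonneg a)
  map_mul_comm a b := by simp [hφ.map_mul_comm a b]

/-- Pointwise limits of traces are traces. -/
theorem of_tendsto {ι : Type*} {l : Filter ι} [l.NeBot] {f : ι → B →L[ℂ] ℂ}
    (hf : ∀ i, IsTrace (f i)) (h : ∀ b, Tendsto (fun i => f i b) l (𝓝 (φ b))) : IsTrace φ where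
  nonneg a := ge_of_tendsto' (h _) fun i => (hf i).nonneg a
  map_mul_comm a b :=
    tendsto_nhds_unique ((h (a * b)).congr fun i => (hf i).map_mul_comm a b) (h (b * a))

theorem re_le_norm (φ : B →L[ℂ] ℂ) {e : B} (he : ‖e‖ ≤ 1) : (φ e).re ≤ ‖φ‖ :=
  (Complex.re_le_norm _).trans (by simpa using φ.le_of_opNorm_le_of_le le_rfl he)

variable [PartialOrder B] [StarOrderedRing B]

theorem map_nonneg (hφ : IsTrace φ) {a : B} (ha : 0 ≤ a) : 0 ≤ φ a := by
  obtain ⟨b, rfl⟩ := CStarAlgebra.nonneg_iff_eq_star_mul_self.1 ha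
  exact hφ.nonneg b

theorem re_mono (hφ : IsTrace φ) {a b : B} (hab : a ≤ b) : (φ a).re ≤ (φ b).re := by
  have h := (Complex.nonneg_iff.1 (hφ.map_nonneg (sub_nonneg.2 hab))).1
  rw [map_sub, Complex.sub_re] at h
  linarith

theorem re_nonneg (hφ : IsTrace φ) {a : B} (ha : 0 ≤ a) : 0 ≤ (φ a).re :=
  (Complex.nonneg_iff.1 (hφ.map_nonneg ha)).1

/-- A trace as a positive linear map. -/
noncomputable def toPositiveLinearMap (hφ : IsTrace φ) : B →ₚ[ℂ] ℂ :=
  PositiveLinearMap.mk₀ (φ : B →ₗ[ℂ] ℂ) fun _ ha => hφ.map_nonneg ha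

theorem map_star (hφ : IsTrace φ) (a : B) : φ (star a) = star (φ a) :=
  StarHomClass.map_star hφ.toPositiveLinearMap a

theorem im_eq_zero (hφ : IsTrace φ) {a : B} (ha : IsSelfAdjoint a) : (φ a).im = 0 := by
  have h := hφ.map_star a
  rw [ha.star_eq] at h
  exact Complex.conj_eq_iff_im.1 h.symm

/-- Cauchy–Schwarz for the pre-GNS inner product of `φ`. -/
theorem norm_map_star_mul_sq_le (hφ : IsTrace φ) (a b : B) :
    ‖φ (star a * b)‖ ^ 2 ≤ (φ (star a * a)).re * (φ (star b * b)).re := by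
  let f := hφ.toPositiveLinearMap
  have h := norm_inner_le_norm (𝕜 := ℂ) (f.toPreGNS a) (f.toPreGNS b)
  have h1 : ∀ x, ‖f.toPreGNS x‖ ^ 2 = (φ (star x * x)).re := fun x => by
    rw [PositiveLinearMap.preGNS_norm_def, Real.sq_sqrt]
    · rfl
    · exact hφ.re_nonneg (star_mul_self_nonneg x)
  calc ‖φ (star a * b)‖ ^ 2 ≤ (‖f.toPreGNS a‖ * ‖f.toPreGNS b‖) ^ 2 :=
        pow_le_pow_left₀ (norm_nonneg _) h 2
    _ = _ := by rw [mul_pow, h1, h1]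

theorem map_star_mul_self_mul_le (hφ : IsTrace φ) (x y : B) :
    (φ (star (y * x) * (y * x))).re ≤ ‖y‖ ^ 2 * (φ (star x * x)).re := by
  have h : star (y * x) * (y * x) ≤ ‖y‖ ^ 2 • (star x * x) := by
    rw [star_mul, ← mul_assoc, mul_assoc _ (star y), sq, ← CStarRing.norm_star_mul_self (x := y)]
    exact CStarAlgebra.star_left_conjugate_le_norm_smul
  have h2 := hφ.re_mono h
  rwa [φ.map_smul_of_tower, Complex.smul_re, smul_eq_mul] at h2

theorem mul_self_le {e : B} (he : 0 ≤ e) (he1 : ‖e‖ ≤ 1) : e * e ≤ e := by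
  have hs : IsSelfAdjoint e := .of_nonneg he
  have h1 : e * e = cfcₙ (fun x : ℝ => x * x) e := by
    rw [cfcₙ_mul (fun x : ℝ => x) (fun x : ℝ => x) e, cfcₙ_id' ℝ e]
  conv_rhs => rw [← cfcₙ_id' ℝ e]
  rw [h1]
  refine cfcₙ_mono fun x hx => ?_
  have h0 : 0 ≤ x := quasispectrum_nonneg_of_nonneg e he x hx
  have h2 : ‖x‖ ≤ ‖e‖ := by
    have := NonUnitalIsometricContinuousFunctionalCalculus.norm_quasispectrum_le (𝕜 := ℝ) e hx hs
    exact this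
  rw [Real.norm_eq_abs, abs_of_nonneg h0] at h2
  nlinarith

/-- A trace almost attains its norm along the canonical approximate unit. -/
theorem eventually_lt_re (hφ : IsTrace φ) {ε : ℝ} (hε : 0 < ε) :
    ∀ᶠ u in CStarAlgebra.approximateUnit B, ‖φ‖ - ε < (φ u).re := by
  -- Splitting off small norms makes `‖φ‖ - ε / 2` positive, so that it can be squared in `h6`.
  by_cases h0 : ‖φ‖ ≤ ε / 2
  · filter_upwards [(CStarAlgebra.increasingApproximateUnit B).eventually_nonneg] with u hu
    linarith [hφ.re_nonneg hu]
  push Not at h0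
  have hpos : 0 < ‖φ‖ := by linarith
  obtain ⟨x, hx1, hx⟩ := φ.exists_lt_apply_of_lt_opNorm (show ‖φ‖ - ε / 2 < ‖φ‖ by linarith)
  have ht : Tendsto (fun u => ‖φ (u * x)‖) (CStarAlgebra.approximateUnit B) (𝓝 ‖φ x‖) :=
    ((φ.continuous.tendsto x).comp
      ((CStarAlgebra.increasingApproximateUnit B).tendsto_mul_right x)).norm
  filter_upwards [(CStarAlgebra.increasingApproximateUnit B).eventually_nonneg,
    (CStarAlgebra.increasingApproximateUnit B).eventually_norm, ht.eventually_const_lt hx]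
    with u hu hu1 hux
  have hs : star u = u := (IsSelfAdjoint.of_nonneg hu).star_eq
  have h1 := hφ.norm_map_star_mul_sq_le u x
  rw [hs] at h1
  have h2 : (φ (u * u)).re ≤ (φ u).re := hφ.re_mono (mul_self_le hu hu1)
  have h3 : (φ (star x * x)).re ≤ ‖φ‖ :=
    re_le_norm φ (by rw [CStarRing.norm_star_mul_self]; nlinarith [norm_nonneg x])
  have h4 : 0 ≤ (φ u).re := hφ.re_nonneg hu
  have h5 : ‖φ (u * x)‖ ^ 2 ≤ (φ u).re * ‖φ‖ :=
    h1.trans (mul_le_mul h2 h3 (hφ.re_nonneg (star_mul_self_nonneg x)) h4)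
  have h6 : (‖φ‖ - ε / 2) ^ 2 ≤ ‖φ (u * x)‖ ^ 2 := by gcongr
  nlinarith [sq_nonneg ε]

/-- A single element of the approximate unit almost attains both norms. -/
theorem norm_add (hφ : IsTrace φ) (hψ : IsTrace ψ) : ‖φ + ψ‖ = ‖φ‖ + ‖ψ‖ := by
  refine le_antisymm (norm_add_le _ _) (le_of_forall_pos_le_add fun ε hε => ?_)
  obtain ⟨u, h1, h2, h3⟩ := ((hφ.eventually_lt_re (half_pos hε)).and
    ((hψ.eventually_lt_re (half_pos hε)).and
      (CStarAlgebra.increasingApproximateUnit B).eventually_norm)).exists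
  have h4 := re_le_norm (φ + ψ) h3
  rw [add_apply, Complex.add_re] at h4
  linarith

end IsTrace

/-- A bounded family of functionals has a pointwise limit along any ultrafilter. -/
theorem exists_tendsto_ultrafilter {ι E : Type*} [SeminormedAddCommGroup E] [NormedSpace ℂ E]
    (V : Ultrafilter ι) {f : ι → E →L[ℂ] ℂ} {C : ℝ} (hC : 0 ≤ C) (hf : ∀ i, ‖f i‖ ≤ C) :
    ∃ F : E →L[ℂ] ℂ, (∀ x, Tendsto (fun i => f i x) V (𝓝 (F x))) ∧ ‖F‖ ≤ C := by
  have key : ∀ x, ∃ L : ℂ, ‖L‖ ≤ C * ‖x‖ ∧ Tendsto (fun i => f i x) V (𝓝 L) := fun x => by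
    obtain ⟨L, hL, hVL⟩ := (isCompact_closedBall (0 : ℂ) (C * ‖x‖)).ultrafilter_le_nhds
      (V.map fun i => f i x) (by
        simp only [le_principal_iff, Ultrafilter.mem_coe, Ultrafilter.mem_map]
        refine Filter.univ_mem' fun i => ?_
        simpa using (f i).le_of_opNorm_le (hf i) x)
    exact ⟨L, by simpa using hL, hVL⟩
  choose L hL hVL using key
  let F : E →ₗ[ℂ] ℂ :=
    { toFun := L
      map_add' := fun x y => tendsto_nhds_unique (hVL (x + y))
        (((hVL x).add (hVL y)).congr fun i => by simp)
      map_smul' := fun c x => tendsto_nhds_unique (hVL (c • x))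
        (((hVL x).const_smul c).congr fun i => by simp) }
  exact ⟨F.mkContinuous C hL, hVL, F.mkContinuous_norm_le hC hL⟩

/-! ### Approximate Radon–Nikodym densities of traces -/

namespace IsTrace

variable {B : Type*} [NonUnitalCStarAlgebra B] [PartialOrder B] [StarOrderedRing B]
  {φ ψ : B →L[ℂ] ℂ}

/-- Truncation of a self-adjoint element to the interval `[0, 1]`. -/
theorem exists_truncation {a : B} (ha : IsSelfAdjoint a) :
    ∃ b : B, 0 ≤ b ∧ ‖b‖ ≤ 1 ∧ b * b ≤ a * a ∧ b * b - (2 : ℝ) • b ≤ a * a - (2 : ℝ) • a := by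
  -- The nearest-point map onto `[0, 1]` brings every real closer to `0` and to `1`: `g² ≤ x²` and
  -- `(g - 1)² ≤ (x - 1)²`. The second is stated with the unit cancelled.
  let g : ℝ → ℝ := fun x => max 0 (min 1 x)
  have hg : Continuous g := by fun_prop
  have hg0 : g 0 = 0 := by simp [g]
  have hg1 : ∀ x, 0 ≤ g x ∧ g x ≤ 1 := fun x => ⟨le_max_left _ _, by simp [g]⟩
  have hbb : cfcₙ g a * cfcₙ g a = cfcₙ (fun x => g x * g x) a :=
    (cfcₙ_mul g g a hg.continuousOn hg0 hg.continuousOn hg0).symm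
  have haa : a * a = cfcₙ (fun x : ℝ => x * x) a := by
    rw [cfcₙ_mul (fun x : ℝ => x) (fun x : ℝ => x) a, cfcₙ_id' ℝ a]
  have hb2 : (2 : ℝ) • cfcₙ g a = cfcₙ (fun x => (2 : ℝ) • g x) a :=
    (cfcₙ_smul (2 : ℝ) g a hg.continuousOn hg0).symm
  have ha2 : (2 : ℝ) • a = cfcₙ (fun x : ℝ => (2 : ℝ) • x) a := by
    rw [cfcₙ_smul (2 : ℝ) (fun x : ℝ => x) a, cfcₙ_id' ℝ a]
  refine ⟨cfcₙ g a, cfcₙ_nonneg fun x _ => (hg1 x).1, norm_cfcₙ_le fun x _ => ?_, ?_, ?_⟩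
  · rw [Real.norm_eq_abs, abs_of_nonneg (hg1 x).1]
    exact (hg1 x).2
  · rw [hbb, haa]
    refine cfcₙ_mono (fun x _ => ?_) (by fun_prop) (by fun_prop) (by simp [hg0]) (by simp)
    rcases le_total x 0 with h | h
    · have : g x = 0 := by simp [g, h]
      rw [this]; nlinarith
    · have : g x ≤ x := by simp [g, h]
      nlinarith [(hg1 x).1]
  · rw [hb2, ha2, hbb, haa, ← cfcₙ_sub _ _ a (by fun_prop) (by simp [hg0]) (by fun_prop)
      (by simp [hg0]), ← cfcₙ_sub _ _ a (by fun_prop) (by simp) (by fun_prop) (by simp)]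
    refine cfcₙ_mono (fun x _ => ?_) (by fun_prop) (by fun_prop) (by simp [hg0]) (by simp)
    simp only [smul_eq_mul]
    rcases le_total x 0 with h | h
    · have : g x = 0 := by simp [g, h]
      rw [this]; nlinarith
    · rcases le_total x 1 with h' | h'
      · have : g x = x := by simp [g, h, h']
        rw [this]
      · have : g x = 1 := by simp [g, h']
        rw [this]; nlinarith [sq_nonneg (x - 1)]

theorem im_map_mul_eq_zero (hφ : IsTrace φ) {a b : B} (ha : IsSelfAdjoint a)
    (hb : IsSelfAdjoint b) : (φ (a * b)).im = 0 := by
  have h := hφ.map_star (a * b)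
  rw [star_mul, ha.star_eq, hb.star_eq, hφ.map_mul_comm b a] at h
  exact Complex.conj_eq_iff_im.1 h.symm

/-- Near-minimizers in `[0, 1]` of the quadratic functional `a ↦ (φ + ψ) (a²) - 2 φ(a)`: they
approximately represent `φ` in the `2`-norm of `φ + ψ`. -/
theorem exists_approx_density (hφ : IsTrace φ) (hψ : IsTrace ψ) {δ : ℝ} (hδ : 0 < δ) :
    ∃ a : B, 0 ≤ a ∧ ‖a‖ ≤ 1 ∧ ∀ x, IsSelfAdjoint x →
      ((φ + ψ) (a * x) - φ x).re ^ 2 ≤ δ * ((φ + ψ) (x * x)).re := by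
  have hs : IsTrace (φ + ψ) := hφ.add hψ
  let J : B → ℝ := fun b => ((φ + ψ) (b * b)).re - 2 * (φ b).re
  let K : Set B := {b | 0 ≤ b ∧ ‖b‖ ≤ 1}
  have hK : (J '' K).Nonempty := ⟨J 0, 0, ⟨le_rfl, by simp⟩, rfl⟩
  have hKb : BddBelow (J '' K) := by
    refine ⟨-(2 * ‖φ‖), ?_⟩
    rintro _ ⟨b, ⟨hb, hb1⟩, rfl⟩
    have h1 := re_le_norm φ hb1
    have h2 : 0 ≤ ((φ + ψ) (b * b)).re :=
      hs.re_nonneg (IsSelfAdjoint.of_nonneg hb).mul_self_nonneg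
    change _ ≤ ((φ + ψ) (b * b)).re - 2 * (φ b).re
    linarith
  -- Truncation does not increase `J`, so the infimum over `K` bounds `J` on all self-adjoint
  -- elements and the perturbations `a + t • x` may leave `K`.
  have hmin : ∀ a, IsSelfAdjoint a → sInf (J '' K) ≤ J a := fun a ha => by
    obtain ⟨b, hb, hb1, hba, hba'⟩ := exists_truncation ha
    refine (csInf_le hKb ⟨b, ⟨hb, hb1⟩, rfl⟩).trans ?_
    have h1 := hψ.re_mono hba
    have h2 := hφ.re_mono hba'
    simp only [map_sub, φ.map_smul_of_tower, Complex.sub_re, Complex.smul_re, smul_eq_mul] at h2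
    simp only [J, add_apply, Complex.add_re]
    linarith
  obtain ⟨_, ⟨a, ⟨ha, ha1⟩, rfl⟩, hJa⟩ := exists_lt_of_csInf_lt hK
    (show sInf (J '' K) < sInf (J '' K) + δ by linarith)
  refine ⟨a, ha, ha1, fun x hx => ?_⟩
  have has : IsSelfAdjoint a := .of_nonneg ha
  have hquad : ∀ t : ℝ, 0 ≤ ((φ + ψ) (x * x)).re * (t * t) +
      (2 * ((φ + ψ) (a * x) - φ x).re) * t + δ := fun t => by
    have h1 := hmin (a + t • x) (has.add ((IsSelfAdjoint.all t).smul hx))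
    have h2 : J (a + t • x) = J a + 2 * ((φ + ψ) (a * x) - φ x).re * t +
        ((φ + ψ) (x * x)).re * (t * t) := by
      have h3 : (a + t • x) * (a + t • x) = a * a + t • (a * x) + t • (x * a) +
          (t * t) • (x * x) := by
        simp only [add_mul, mul_add, smul_mul_assoc, mul_smul_comm, smul_add, smul_smul]
        abel
      simp only [J, h3, map_add, ContinuousLinearMap.map_smul_of_tower, Complex.add_re,
        Complex.sub_re, Complex.smul_re, smul_eq_mul, hs.map_mul_comm x a]
      ring
    linarith
  have h := discrim_le_zero hquad
  rw [discrim] at h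
  nlinarith

/-- The parallelogram law with the `p + q` term dropped. -/
theorem re_map_star_mul_self_sub_le (hφ : IsTrace φ) (p q : B) :
    (φ (star (p - q) * (p - q))).re ≤
      2 * (φ (star p * p)).re + 2 * (φ (star q * q)).re := by
  have h := hφ.re_nonneg (star_mul_self_nonneg (p + q))
  have h2 : star (p - q) * (p - q) + star (p + q) * (p + q) =
      (2 : ℝ) • (star p * p) + (2 : ℝ) • (star q * q) := by
    simp only [star_add, star_sub, add_mul, mul_add, sub_mul, mul_sub, two_smul]
    abel
  have h3 := congrArg (fun z => (φ z).re) h2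
  simp only [map_add, φ.map_smul_of_tower, Complex.add_re, Complex.smul_re, smul_eq_mul] at h3
  linarith

/-- Approximate densities are approximately central. -/
theorem re_commutator_le (hφ : IsTrace φ) (hψ : IsTrace ψ) {δ : ℝ} {a y : B}
    (ha : IsSelfAdjoint a) (hy : IsSelfAdjoint y)
    (hax : ∀ x, IsSelfAdjoint x →
      ((φ + ψ) (a * x) - φ x).re ^ 2 ≤ δ * ((φ + ψ) (x * x)).re) (hδ : 0 ≤ δ) :
    ((φ + ψ) (star (a * y - y * a) * (a * y - y * a))).re ≤ 4 * δ * ‖y‖ ^ 2 := by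
  have hs : IsTrace (φ + ψ) := hφ.add hψ
  have hI : ∀ p q : B, IsSelfAdjoint p → IsSelfAdjoint q →
      IsSelfAdjoint (Complex.I • (p * q - q * p)) := fun p q hp hq => by
    rw [IsSelfAdjoint, star_smul, star_sub, star_mul, star_mul, hp.star_eq, hq.star_eq,
      Complex.star_def, Complex.conj_I, neg_smul, ← smul_neg, neg_sub]
  have hII : ∀ p : B, star (Complex.I • p) * (Complex.I • p) = star p * p := fun p => by
    rw [star_smul, smul_mul_smul_comm, Complex.star_def, Complex.conj_I]
    simp
  set x := Complex.I • (a * y - y * a) with hxdef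
  have hx : IsSelfAdjoint x := hI a y ha hy
  -- Test the density on `w = i[y, x]`, where `x = i[a, y]`: traciality gives `(φ + ψ) (a w) = (φ +
  -- ψ) (x²)` and `φ w = 0`, while `(φ + ψ) (w²) ≤ 4 ‖y‖² (φ + ψ) (x²)`. One factor `(φ + ψ) (x²)`
  -- then cancels.
  have hw := hax _ (hI y x hy hx)
  have hX : star (a * y - y * a) * (a * y - y * a) = x * x := by
    rw [← hII, ← hxdef, hx.star_eq]
  have h1 : (φ + ψ) (a * (Complex.I • (y * x - x * y))) = (φ + ψ) (x * x) := by
    conv_rhs => rw [hxdef, smul_mul_assoc, sub_mul, ← hxdef]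
    rw [mul_smul_comm, mul_sub, map_smul, map_smul, map_sub, map_sub, ← mul_assoc a x y,
      hs.map_mul_comm (a * x) y, mul_assoc a y x, mul_assoc y a x]
  have h2 : φ (Complex.I • (y * x - x * y)) = 0 := by
    rw [map_smul, map_sub, hφ.map_mul_comm x y, sub_self, smul_zero]
  have h3 : ((φ + ψ) ((Complex.I • (y * x - x * y)) * (Complex.I • (y * x - x * y)))).re ≤
      4 * ‖y‖ ^ 2 * ((φ + ψ) (x * x)).re := by
    have h4 := hs.re_map_star_mul_self_sub_le (y * x) (x * y)
    rw [← hII, (hI y x hy hx).star_eq] at h4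
    have h5 := hs.map_star_mul_self_mul_le x y
    have h6 : (φ + ψ) (star (x * y) * (x * y)) = (φ + ψ) (star (y * x) * (y * x)) := by
      simp only [star_mul, hx.star_eq, hy.star_eq]
      rw [show y * x * (x * y) = y * (x * x * y) by simp only [mul_assoc], hs.map_mul_comm,
        show x * y * (y * x) = x * (y * y * x) by simp only [mul_assoc], hs.map_mul_comm x,
        show x * x * y * y = (x * x) * (y * y) by simp only [mul_assoc], hs.map_mul_comm]
      simp only [mul_assoc]
    rw [h6] at h4
    rw [hx.star_eq] at h5
    linarith
  rw [h1, h2, sub_zero] at hw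
  rw [hX]
  have hX0 : 0 ≤ ((φ + ψ) (x * x)).re := hs.re_nonneg hx.mul_self_nonneg
  have h7 : ((φ + ψ) (x * x)).re * ((φ + ψ) (x * x)).re ≤
      (4 * δ * ‖y‖ ^ 2) * ((φ + ψ) (x * x)).re := by
    nlinarith [mul_le_mul_of_nonneg_left h3 hδ]
  rcases hX0.eq_or_lt with h | h
  · rw [← h]; positivity
  · exact le_of_mul_le_mul_right h7 h

end IsTrace

/-! ### Separation of mutually singular traces -/

/-- Two traces are mutually singular if `0` is the only trace dominated by both. -/
def TraceSingular {B : Type*} [NonUnitalCStarAlgebra B] (φ ψ : B →L[ℂ] ℂ) : Prop :=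
  ∀ χ : B →L[ℂ] ℂ, IsTrace χ → IsTrace (φ - χ) → IsTrace (ψ - χ) → χ = 0

namespace IsTrace

variable {B : Type*} [NonUnitalCStarAlgebra B] {φ ψ : B →L[ℂ] ℂ}

theorem map_mul_star_mul_self (hφ : IsTrace φ) (a x : B) :
    φ (a * (star x * x)) = φ (x * a * star x) := by
  rw [← mul_assoc, hφ.map_mul_comm, mul_assoc, ← mul_assoc]

variable [PartialOrder B] [StarOrderedRing B]

theorem conjugate_le {a : B} (ha : 0 ≤ a) (ha1 : ‖a‖ ≤ 1) (x : B) :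
    x * a * star x ≤ x * star x := by
  refine (CStarAlgebra.star_right_conjugate_le_norm_smul (.of_nonneg ha)).trans ?_
  exact (smul_le_smul_of_nonneg_right ha1 (mul_star_self_nonneg x)).trans (one_smul ℝ _).le

/-- If the approximate densities `a n` of `φ` with respect to `φ + ψ` become exact in the limit,
then, along an ultrafilter, `lim ψ (a n * ·)` is a trace dominated by `φ` and `ψ`. -/
theorem exists_common_minorant (hφ : IsTrace φ) (hψ : IsTrace ψ) {ι : Type*} (V : Ultrafilter ι)
    {a : ι → B} {δ : ι → ℝ} (hδ0 : ∀ n, 0 ≤ δ n) (hδ : Tendsto δ V (𝓝 0))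
    (ha : ∀ n, 0 ≤ a n) (ha1 : ∀ n, ‖a n‖ ≤ 1)
    (hax : ∀ n x, IsSelfAdjoint x →
      ((φ + ψ) (a n * x) - φ x).re ^ 2 ≤ δ n * ((φ + ψ) (x * x)).re) :
    ∃ χ : B →L[ℂ] ℂ, IsTrace χ ∧ IsTrace (φ - χ) ∧ IsTrace (ψ - χ) ∧
      ∀ x, IsSelfAdjoint x → Tendsto (fun n => φ (a n * x)) V (𝓝 (φ x - χ x)) := by
  have hs : IsTrace (φ + ψ) := hφ.add hψ
  have has : ∀ n, IsSelfAdjoint (a n) := fun n => .of_nonneg (ha n)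
  obtain ⟨χ, hχ, -⟩ := exists_tendsto_ultrafilter V
    (f := fun n => ψ.comp (ContinuousLinearMap.mul ℂ B (a n))) (norm_nonneg ψ) fun n => by
      refine (ψ.opNorm_comp_le _).trans ?_
      exact mul_le_of_le_one_right (norm_nonneg _)
        ((ContinuousLinearMap.opNorm_mul_apply_le ℂ B (a n)).trans (ha1 n))
  replace hχ : ∀ x, Tendsto (fun n => ψ (a n * x)) V (𝓝 (χ x)) := hχ
  have hφχ : ∀ x, IsSelfAdjoint x → Tendsto (fun n => φ (a n * x)) V (𝓝 (φ x - χ x)) := by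
    intro x hx
    have h1 : Tendsto (fun n => (φ + ψ) (a n * x) - φ x) V (𝓝 0) := by
      rw [tendsto_zero_iff_norm_tendsto_zero]
      have h2 : Tendsto (fun n => √(δ n * ((φ + ψ) (x * x)).re)) V (𝓝 0) := by
        simpa using (hδ.mul_const ((φ + ψ) (x * x)).re).sqrt
      refine squeeze_zero (fun n => norm_nonneg _) (fun n => ?_) h2
      -- The quantity is real, so the bound on its real part bounds its norm.
      have him : ((φ + ψ) (a n * x) - φ x).im = 0 := by
        rw [Complex.sub_im, hs.im_map_mul_eq_zero (has n) hx, hφ.im_eq_zero hx, sub_zero]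
      rw [← Complex.abs_re_eq_norm.2 him]
      exact Real.abs_le_sqrt (hax n x hx)
    have h3 := (h1.sub (hχ x)).add_const (φ x)
    rw [zero_sub, neg_add_eq_sub] at h3
    exact h3.congr fun n => by rw [add_apply]; ring
  -- The defect is `ψ` of the adjoint of `[a n, y]` times `x`; by Cauchy–Schwarz it vanishes in the
  -- limit with the 2-norm of the commutator.
  have hcomm_sa : ∀ y x, IsSelfAdjoint y → χ (x * y) = χ (y * x) := by
    intro y x hy
    refine sub_eq_zero.1 (tendsto_nhds_unique ((hχ (x * y)).sub (hχ (y * x))) ?_)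
    rw [tendsto_zero_iff_norm_tendsto_zero]
    have h2 : Tendsto (fun n => √(4 * δ n * ‖y‖ ^ 2 * (ψ (star x * x)).re)) V (𝓝 0) := by
      simpa using
        (((hδ.const_mul 4).mul_const (‖y‖ ^ 2)).mul_const (ψ (star x * x)).re).sqrt
    refine squeeze_zero (fun n => norm_nonneg _) (fun n => Real.le_sqrt_of_sq_le ?_) h2
    have hz : star (a n * y - y * a n) = y * a n - a n * y := by
      rw [star_sub, star_mul, star_mul, (has n).star_eq, hy.star_eq]
    have h3 : ψ (a n * (x * y)) - ψ (a n * (y * x)) = ψ (star (a n * y - y * a n) * x) := by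
      rw [hz, ← mul_assoc, hψ.map_mul_comm _ y, ← map_sub, sub_mul, mul_assoc, mul_assoc]
    rw [h3]
    refine (hψ.norm_map_star_mul_sq_le _ _).trans ?_
    refine mul_le_mul_of_nonneg_right ?_ (hψ.re_nonneg (star_mul_self_nonneg x))
    refine le_trans ?_ (re_commutator_le hφ hψ (has n) hy (hax n) (hδ0 n))
    rw [add_apply, Complex.add_re]
    linarith [hφ.re_nonneg (star_mul_self_nonneg (a n * y - y * a n))]
  have hcomm : ∀ x y, χ (x * y) = χ (y * x) := by
    intro x y
    rw [← realPart_add_I_smul_imaginaryPart y]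
    simp only [mul_add, add_mul, map_add, mul_smul_comm, smul_mul_assoc, map_smul]
    rw [hcomm_sa _ x (realPart y).2, hcomm_sa _ x (imaginaryPart y).2]
  refine ⟨χ, ⟨fun x => ?_, hcomm⟩, ⟨fun x => ?_, fun x y => ?_⟩, ⟨fun x => ?_, fun x y => ?_⟩, hφχ⟩
  · refine ge_of_tendsto' (hχ _) fun n => ?_
    rw [hψ.map_mul_star_mul_self]
    exact hψ.map_nonneg (star_right_conjugate_nonneg (ha n) x)
  · refine ge_of_tendsto' (hφχ _ (.star_mul_self x)) fun n => ?_
    rw [hφ.map_mul_star_mul_self]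
    exact hφ.map_nonneg (star_right_conjugate_nonneg (ha n) x)
  · simp only [sub_apply, hcomm x y, hφ.map_mul_comm x y]
  · refine ge_of_tendsto' ((hχ (star x * x)).const_sub (ψ (star x * x))) fun n => ?_
    rw [hψ.map_mul_star_mul_self, hψ.map_mul_comm (star x), ← map_sub]
    exact hψ.map_nonneg (sub_nonneg.2 (conjugate_le (ha n) (ha1 n) x))
  · simp only [sub_apply, hcomm x y, hψ.map_mul_comm x y]

/-- Mutually singular traces are almost separated by a positive contraction. -/
theorem exists_separating (hφ : IsTrace φ) (hψ : IsTrace ψ) (hsing : TraceSingular φ ψ)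
    {ε : ℝ} (hε : 0 < ε) :
    ∃ e : B, 0 ≤ e ∧ ‖e‖ ≤ 1 ∧ ‖φ‖ - ε ≤ (φ e).re ∧ (ψ e).re ≤ ε := by
  have hs : IsTrace (φ + ψ) := hφ.add hψ
  choose a ha ha1 hax using fun n : ℕ =>
    exists_approx_density hφ hψ (δ := 1 / ((n : ℝ) + 1)) (by positivity)
  have hδ : Tendsto (fun n : ℕ => 1 / ((n : ℝ) + 1)) (hyperfilter ℕ) (𝓝 0) :=
    tendsto_one_div_add_atTop_nhds_zero_nat.mono_left
      (Nat.hyperfilter_le_atTop)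
  obtain ⟨χ, hχ, hφχ, hψχ, hlim⟩ := exists_common_minorant hφ hψ (hyperfilter ℕ)
    (fun n => by positivity) hδ ha ha1 hax
  -- With `χ = 0`, `φ (a n * x) → φ x` for self-adjoint `x`.
  obtain rfl := hsing χ hχ hφχ hψχ
  set η := ε / 3 with hη
  have hη0 : 0 < η := by positivity
  obtain ⟨u, hu, hu0, hu1⟩ := ((hφ.eventually_lt_re hη0).and
    ((CStarAlgebra.increasingApproximateUnit B).eventually_nonneg.and
      (CStarAlgebra.increasingApproximateUnit B).eventually_norm)).exists
  have hus : IsSelfAdjoint u := .of_nonneg hu0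
  have h1 := (hlim u hus).norm
  rw [zero_apply, sub_zero] at h1
  have h2 : Tendsto (fun n : ℕ => 1 / ((n : ℝ) + 1) * ‖φ + ψ‖) (hyperfilter ℕ) (𝓝 0) := by
    simpa using hδ.mul_const ‖φ + ψ‖
  obtain ⟨n, hn1, hn2⟩ := ((h1.eventually_const_lt (hu.trans_le (Complex.re_le_norm _))).and
    (h2.eventually_lt_const (show 0 < η ^ 2 by positivity))).exists
  have has : IsSelfAdjoint (a n) := .of_nonneg (ha n)
  have haa1 : ‖a n * a n‖ ≤ 1 :=
    (norm_mul_le _ _).trans (mul_le_one₀ (ha1 n) (norm_nonneg _) (ha1 n))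
  have haa0 : 0 ≤ a n * a n := has.mul_self_nonneg
  have huu1 : ‖u * u‖ ≤ 1 :=
    (norm_mul_le _ _).trans (mul_le_one₀ hu1 (norm_nonneg _) hu1)
  -- Cauchy–Schwarz gives `(‖φ‖ - η)² ≤ ‖φ (a n * u)‖² ≤ φ (a n²) ‖φ‖`.
  have hφaa : ‖φ‖ - 2 * η ≤ (φ (a n * a n)).re := by
    have h0 := hφ.re_nonneg haa0
    rcases le_or_gt ‖φ‖ η with h | h
    · linarith
    have h3 := hφ.norm_map_star_mul_sq_le (a n) u
    rw [has.star_eq, hus.star_eq] at h3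
    have h4 : (φ (a n * a n)).re * (φ (u * u)).re ≤ (φ (a n * a n)).re * ‖φ‖ :=
      mul_le_mul_of_nonneg_left (re_le_norm φ huu1) h0
    have h5 : (‖φ‖ - η) ^ 2 ≤ ‖φ (a n * u)‖ ^ 2 := by gcongr
    nlinarith [sq_nonneg η]
  -- Testing the density on `a n` itself gives `(φ + ψ) (a n²) ≤ φ (a n) + η ≤ ‖φ‖ + η`; subtracting
  -- `hφaa` leaves `ψ (a n²) ≤ 3 η = ε`.
  have hsaa : ((φ + ψ) (a n * a n) - φ (a n)).re ≤ η := by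
    refine le_of_abs_le (abs_le_of_sq_le_sq ?_ hη0.le)
    refine (hax n (a n) has).trans (le_trans ?_ hn2.le)
    exact mul_le_mul_of_nonneg_left (re_le_norm _ haa1) (by positivity)
  rw [add_apply, Complex.sub_re, Complex.add_re] at hsaa
  have hφa := re_le_norm φ (ha1 n)
  exact ⟨a n * a n, haa0, haa1, by linarith, by linarith⟩

/-- Finitely many states that are mutually singular to a trace `ψ` are simultaneously almost
separated from `ψ` by a positive contraction. -/
theorem exists_separating_finset {ι : Type*} (s : Finset ι) {f : ι → B →L[ℂ] ℂ}
    (hf : ∀ i ∈ s, f i ∈ tracialStates B) (hψ : IsTrace ψ)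
    (hsing : ∀ i ∈ s, TraceSingular (f i) ψ) {ε : ℝ} (hε : 0 < ε) :
    ∃ e : B, 0 ≤ e ∧ ‖e‖ ≤ 1 ∧ (∀ i ∈ s, 1 - ε ≤ (f i e).re) ∧ (ψ e).re ≤ ε := by
  -- `N` is large enough for `N / (N + 1) * (1 - ε / 2) ≥ 1 - ε`, and `η` small enough for `s.card *
  -- N * η ≤ ε`.
  obtain ⟨N, hN⟩ := exists_nat_gt (2 / ε)
  have hN0 : (0 : ℝ) < N := (by positivity : 0 < 2 / ε).trans hN
  have hNε : 2 < ε * N := by rwa [div_lt_iff₀' hε] at hN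
  set η : ℝ := ε / (2 * N * (s.card + 1)) with hη
  have hη0 : 0 < η := by positivity
  have hsep : ∀ i, ∃ e : B, 0 ≤ e ∧ (i ∈ s → ‖e‖ ≤ 1 ∧ 1 - min η (ε / 2) ≤ (f i e).re ∧
      (ψ e).re ≤ min η (ε / 2)) := fun i => by
    by_cases hi : i ∈ s
    · obtain ⟨e, h0, h1, h2, h3⟩ := exists_separating (hf i hi).1 hψ (hsing i hi)
        (ε := min η (ε / 2)) (by positivity)
      exact ⟨e, h0, fun _ => ⟨h1, by rwa [(hf i hi).2] at h2, h3⟩⟩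
    · exact ⟨0, le_rfl, fun h => absurd h hi⟩
  choose e he0 he using hsep
  -- This is `x / (1 + x)`, operator monotone on positive elements and with values below `1`.
  -- Applied to `b = N ∑ e i` it gives a contraction that dominates each `g (N e i)`, and `g b ≤ b`
  -- keeps `ψ` small.
  let g : ℝ → ℝ := fun x => 1 - (1 + x)⁻¹
  have hg0 : g 0 = 0 := by simp [g]
  have hgc : ∀ b : B, 0 ≤ b → ContinuousOn g (quasispectrum ℝ b) := fun b hb => by
    have : ∀ x ∈ quasispectrum ℝ b, 1 + x ≠ 0 := fun x hx => by
      have := quasispectrum_nonneg_of_nonneg b hb x hx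
      positivity
    fun_prop (disch := assumption)
  have hle : ∀ b : B, 0 ≤ b → cfcₙ g b ≤ b := fun b hb => by
    conv_rhs => rw [← cfcₙ_id' ℝ b (.of_nonneg hb)]
    refine cfcₙ_mono (fun x hx => ?_) (hgc b hb) (by fun_prop) hg0 rfl
    have h0 := quasispectrum_nonneg_of_nonneg b hb x hx
    simp only [g]
    have : (1 + x)⁻¹ * (1 + x) = 1 := inv_mul_cancel₀ (by positivity)
    have h1 : 0 < (1 + x)⁻¹ := by positivity
    nlinarith
  set b : B := ∑ i ∈ s, (N : ℝ) • e i with hb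
  have hNe : ∀ i, 0 ≤ (N : ℝ) • e i := fun i => smul_nonneg hN0.le (he0 i)
  have hb0 : 0 ≤ b := Finset.sum_nonneg fun i _ => hNe i
  refine ⟨cfcₙ g b, cfcₙ_nonneg fun x hx => ?_, norm_cfcₙ_le fun x hx => ?_, fun i hi => ?_, ?_⟩
  · have h0 := quasispectrum_nonneg_of_nonneg b hb0 x hx
    simpa [g] using inv_le_one_of_one_le₀ (show 1 ≤ 1 + x by linarith)
  · have h0 := quasispectrum_nonneg_of_nonneg b hb0 x hx
    have h1 : (1 + x)⁻¹ ≤ 1 := inv_le_one_of_one_le₀ (show 1 ≤ 1 + x by linarith)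
    have h2 : 0 < (1 + x)⁻¹ := by positivity
    rw [Real.norm_eq_abs, abs_of_nonneg (by simp only [g]; linarith)]
    simp only [g]; linarith
  · obtain ⟨h1, h2, -⟩ := he i hi
    have hmono : cfcₙ g ((N : ℝ) • e i) ≤ cfcₙ g b :=
      CFC.monotoneOn_one_sub_one_add_inv_real (hNe i) hb0
        (Finset.single_le_sum (f := fun i => (N : ℝ) • e i) (fun j _ => hNe j) hi)
    -- On `[0, 1]`, `N x / (N x + 1) ≥ N x / (N + 1)`.
    have hlow : ((N : ℝ) / (N + 1)) • e i ≤ cfcₙ g ((N : ℝ) • e i) := by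
      have hes : IsSelfAdjoint (e i) := .of_nonneg (he0 i)
      have hpos : ∀ x ∈ quasispectrum ℝ (e i), 0 ≤ x := quasispectrum_nonneg_of_nonneg _ (he0 i)
      have hgN : ContinuousOn (fun x : ℝ => g (N * x)) (quasispectrum ℝ (e i)) := by
        have : ∀ x ∈ quasispectrum ℝ (e i), 1 + (N : ℝ) * x ≠ 0 := fun x hx => by
          have := hpos x hx
          positivity
        simp only [g]
        fun_prop (disch := assumption)
      have h3 : ((N : ℝ) / (N + 1)) • e i = cfcₙ (fun x : ℝ => ((N : ℝ) / (N + 1)) • x) (e i) := by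
        rw [cfcₙ_smul _ (fun x : ℝ => x) (e i), cfcₙ_id' ℝ (e i)]
      have h4 : cfcₙ g ((N : ℝ) • e i) = cfcₙ (fun x : ℝ => g (N * x)) (e i) := by
        rw [← cfcₙ_comp_smul (N : ℝ) g (e i) ?_ hg0]
        · rfl
        · rintro _ ⟨x, hx, rfl⟩
          refine ContinuousAt.continuousWithinAt ?_
          have h5 : 1 + (N : ℝ) • x ≠ 0 := by
            have := hpos x hx
            simp only [smul_eq_mul]
            positivity
          simp only [g]
          fun_prop (disch := assumption)
      rw [h3, h4]
      refine cfcₙ_mono (fun x hx => ?_) (by fun_prop) hgN (by simp) (by simp [hg0])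
      have h0 := hpos x hx
      have hx1 : x ≤ 1 := by
        have h5 := NonUnitalIsometricContinuousFunctionalCalculus.norm_quasispectrum_le
          (𝕜 := ℝ) (e i) hx hes
        exact (le_abs_self x).trans (h5.trans h1)
      have h6 : g (N * x) = N * x / (N * x + 1) := by
        simp only [g]
        field_simp
        ring
      rw [h6, smul_eq_mul, div_mul_eq_mul_div]
      gcongr
      exact mul_le_of_le_one_right hN0.le hx1
    have h3 := (hf i hi).1.re_mono (hlow.trans hmono)
    rw [(f i).map_smul_of_tower, Complex.smul_re, smul_eq_mul] at h3
    refine le_trans ?_ h3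
    have h4 : 1 - ε / 2 ≤ (f i (e i)).re := by linarith [min_le_right η (ε / 2)]
    have h5 : (f i (e i)).re ≤ 1 := by
      have := re_le_norm (f i) h1
      rwa [(hf i hi).2] at this
    rw [div_mul_eq_mul_div, le_div_iff₀ (by positivity)]
    nlinarith
  · refine (hψ.re_mono (hle b hb0)).trans ?_
    rw [hb, map_sum, Complex.re_sum]
    have h1 : ∀ i ∈ s, (ψ ((N : ℝ) • e i)).re ≤ N * η := fun i hi => by
      rw [ψ.map_smul_of_tower, Complex.smul_re, smul_eq_mul]
      exact mul_le_mul_of_nonneg_left ((he i hi).2.2.trans (min_le_left _ _)) hN0.le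
    refine (Finset.sum_le_sum h1).trans ?_
    rw [Finset.sum_const, nsmul_eq_mul, hη]
    have h2 : (s.card : ℝ) * (N * (ε / (2 * N * (s.card + 1)))) =
        ε * (s.card / (2 * (s.card + 1))) := by
      field_simp
    rw [h2]
    refine mul_le_of_le_one_right hε.le ((div_le_one (by positivity)).2 ?_)
    linarith [(Nat.cast_nonneg s.card : (0 : ℝ) ≤ s.card)]

end IsTrace

/-! ### Extremal tracial states -/

section Extremal

variable {B : Type*} [NonUnitalCStarAlgebra B] {φ ψ χ : B →L[ℂ] ℂ}

theorem IsTrace.inv_norm_smul_mem (hφ : IsTrace φ) (h0 : φ ≠ 0) :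
    ‖φ‖⁻¹ • φ ∈ tracialStates B :=
  ⟨hφ.smul (by positivity), by
    rw [norm_smul, norm_inv, norm_norm, inv_mul_cancel₀ (norm_ne_zero_iff.2 h0)]⟩

variable [PartialOrder B] [StarOrderedRing B]

theorem IsTrace.norm_add_norm_sub (hχ : IsTrace χ) (hφχ : IsTrace (φ - χ)) :
    ‖χ‖ + ‖φ - χ‖ = ‖φ‖ := by
  rw [← hχ.norm_add hφχ, add_sub_cancel]

/-- A trace dominated by an extremal tracial state is a multiple of it. -/
theorem eq_norm_smul_of_extremal (hφ : φ ∈ extremalTracialStates B) (hχ : IsTrace χ)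
    (hφχ : IsTrace (φ - χ)) : χ = ‖χ‖ • φ := by
  have hsum := hχ.norm_add_norm_sub hφχ
  rw [hφ.1.2] at hsum
  by_cases h0 : χ = 0
  · rw [h0, norm_zero]
    exact (zero_smul ℝ φ).symm
  by_cases h1 : φ - χ = 0
  · rw [h1, norm_zero, add_zero] at hsum
    rw [hsum, one_smul, sub_eq_zero.1 h1]
  have h0' : ‖χ‖ ≠ 0 := norm_ne_zero_iff.2 h0
  have h1' : ‖φ - χ‖ ≠ 0 := norm_ne_zero_iff.2 h1
  -- Norms of traces add, so `‖χ‖` and `‖φ - χ‖` are convex weights.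
  have hmem : φ ∈ openSegment ℝ (‖χ‖⁻¹ • χ) (‖φ - χ‖⁻¹ • (φ - χ)) :=
    ⟨‖χ‖, ‖φ - χ‖, by positivity, by positivity, hsum, by
      rw [smul_inv_smul₀ h0', smul_inv_smul₀ h1', add_sub_cancel]⟩
  have h := hφ.2 (hχ.inv_norm_smul_mem h0) (hφχ.inv_norm_smul_mem h1) hmem
  rw [← h, smul_inv_smul₀ h0']

/-- A common minorant `χ` equals both `‖χ‖ • φ` and `‖χ‖ • ψ`, so `χ ≠ 0` would force `φ = ψ`. -/
theorem traceSingular_of_extremal (hφ : φ ∈ extremalTracialStates B)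
    (hψ : ψ ∈ extremalTracialStates B) (hne : φ ≠ ψ) : TraceSingular φ ψ := by
  intro χ hχ hφχ hψχ
  by_contra h0
  refine hne (smul_right_injective _ (norm_ne_zero_iff.2 h0) ?_)
  simp only
  rw [← eq_norm_smul_of_extremal hφ hχ hφχ, ← eq_norm_smul_of_extremal hψ hχ hψχ]

/-- A sequence of distinct extremal tracial states is separated from its limit along an ultrafilter,
up to a single term `φ i`: the contractions `e k` are uniformly larger at `φ j`, `j ≤ k`, `j ≠ i`,
than at the limit. -/
theorem exists_separating_limit {φ : ℕ → B →L[ℂ] ℂ} (hφ : ∀ j, φ j ∈ extremalTracialStates B)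
    (hinj : Function.Injective φ) {ψ : B →L[ℂ] ℂ} (hψ : IsTrace ψ) (hψ1 : ‖ψ‖ ≤ 1) :
    ∃ (i : ℕ) (α β : ℝ) (e : ℕ → B), 0 ≤ α ∧ α < β ∧ (∀ k, ‖e k‖ ≤ 1) ∧
      (∀ k, (ψ (e k)).re ≤ α) ∧ ∀ k j, j ≤ k → j ≠ i → β ≤ (φ j (e k)).re := by
  by_cases h : ∀ j, TraceSingular (φ j) ψ
  · choose e he0 he1 hφe hψe using fun k : ℕ => IsTrace.exists_separating_finset
      (Finset.range (k + 1)) (f := φ) (fun j _ => (hφ j).1) hψ (fun j _ => h j)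
      (show (0 : ℝ) < 1 / 4 by norm_num)
    exact ⟨0, 1 / 4, 1 - 1 / 4, e, by norm_num, by norm_num, he1, hψe,
      fun k j hj _ => hφe k j (Finset.mem_range.2 (Nat.lt_succ_of_le hj))⟩
  · simp only [TraceSingular, not_forall] at h
    obtain ⟨i, χ, hχ, hφχ, hψχ, h0⟩ := h
    have hc0 : 0 < ‖χ‖ := norm_pos_iff.2 h0
    have hχφ := eq_norm_smul_of_extremal (hφ i) hχ hφχ
    have hsum := hχ.norm_add_norm_sub hψχ
    have hc1 : ‖χ‖ ≤ 1 := by linarith [norm_nonneg (ψ - χ)]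
    choose e he0 he1 hφe hψe using fun k : ℕ => IsTrace.exists_separating_finset
      ((Finset.range (k + 1)).erase i) (f := φ) (fun j _ => (hφ j).1) (hφ i).1.1
      (fun j hj => traceSingular_of_extremal (hφ j) (hφ i) (hinj.ne (Finset.ne_of_mem_erase hj)))
      (show 0 < ‖χ‖ / 4 by positivity)
    -- Since `χ = ‖χ‖ • φ i` and `‖ψ - χ‖ ≤ 1 - ‖χ‖`, smallness of `φ i (e k)` keeps `ψ (e k)` away
    -- from `1`.
    refine ⟨i, 1 - ‖χ‖ + ‖χ‖ * (‖χ‖ / 4), 1 - ‖χ‖ / 4, e, ?_, ?_, he1, fun k => ?_,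
      fun k j hj hji => hφe k j (Finset.mem_erase.2 ⟨hji, Finset.mem_range.2
        (Nat.lt_succ_of_le hj)⟩)⟩
    · nlinarith
    · nlinarith
    · have h1 := IsTrace.re_le_norm (ψ - χ) (he1 k)
      have h2 : (χ (e k)).re = ‖χ‖ * (φ i (e k)).re := by
        conv_lhs => rw [hχφ]
        simp
      have h3 := mul_le_mul_of_nonneg_left (hψe k) hc0.le
      rw [sub_apply, Complex.sub_re] at h1
      linarith

end Extremal

/-! ### Ultralimits of functionals -/

section Ultrapower

variable {A : Type*} [NonUnitalCStarAlgebra A] {U : Ultrafilter ℕ}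

/-- A bounded sequence as an element of `ℓ^∞(A)`. -/
def boundedSeq (a : ℕ → A) (ha : ∃ C, ∀ n, ‖a n‖ ≤ C) : lp (fun _ : ℕ => A) ∞ :=
  ⟨a, memℓp_infty (by
    obtain ⟨C, hC⟩ := ha
    exact ⟨C, by rintro _ ⟨n, rfl⟩; exact hC n⟩)⟩

/-- A bounded sequence of functionals has an ultralimit. -/
theorem exists_isUltralimit (U : Ultrafilter ℕ) {σ : ℕ → A →L[ℂ] ℂ} {C : ℝ} (hC : 0 ≤ C)
    (hσ : ∀ n, ‖σ n‖ ≤ C) :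
    ∃ Φ : CStarUltrapower U A →L[ℂ] ℂ, IsUltralimit U σ Φ ∧ ‖Φ‖ ≤ C := by
  have hev : ∀ n, ∀ a : lp (fun _ : ℕ => A) ∞, ‖σ n (a n)‖ ≤ C * ‖a‖ := fun n a =>
    (σ n).le_of_opNorm_le_of_le (hσ n) (CStarUltrapower.norm_coe_le a n)
  let f : ℕ → lp (fun _ : ℕ => A) ∞ →L[ℂ] ℂ := fun n =>
    LinearMap.mkContinuous
      { toFun := fun a => σ n (a n)
        map_add' := fun a b => by simp
        map_smul' := fun c a => by simp } C (hev n)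
  obtain ⟨F, hF, -⟩ := exists_tendsto_ultrafilter U (f := f) hC
    fun n => LinearMap.mkContinuous_norm_le _ hC _
  have hF : ∀ a : lp (fun _ : ℕ => A) ∞, Tendsto (fun n => σ n (a n)) U (𝓝 (F a)) := hF
  have hbound : ∀ a, ‖F a‖ ≤ C * ‖CStarUltrapower.mk U A a‖ := fun a =>
    le_of_tendsto_of_tendsto' (hF a).norm ((CStarUltrapower.tendsto_norm a).const_mul C)
      fun n => (σ n).le_of_opNorm_le (hσ n) (a n)
  let G : CStarUltrapower U A →ₗ[ℂ] ℂ :=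
    (CStarUltrapower.nullSeq U A).liftQ (F : lp (fun _ : ℕ => A) ∞ →ₗ[ℂ] ℂ) fun a ha => by
      have h0 : CStarUltrapower.mk U A a = 0 := by
        rw [← map_zero (CStarUltrapower.mk U A)]
        exact CStarUltrapower.mk_eq_mk.2 (by simpa using ha)
      have h1 := hbound a
      rw [h0, norm_zero, mul_zero] at h1
      exact norm_le_zero_iff.1 h1
  have hG : ∀ a, G (CStarUltrapower.mk U A a) = F a := fun a => rfl
  have hGb : ∀ x, ‖G x‖ ≤ C * ‖x‖ := fun x => by
    obtain ⟨a, rfl⟩ := CStarUltrapower.mk_surjective x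
    exact hbound a
  exact ⟨G.mkContinuous C hGb, hF, G.mkContinuous_norm_le hC hGb⟩

/-- An ultralimit of traces is a trace. -/
theorem IsUltralimit.isTrace {σ : ℕ → A →L[ℂ] ℂ} {Φ : CStarUltrapower U A →L[ℂ] ℂ}
    (h : IsUltralimit U σ Φ) (hσ : ∀ n, IsTrace (σ n)) : IsTrace Φ where
  nonneg x := by
    obtain ⟨a, rfl⟩ := CStarUltrapower.mk_surjective x
    rw [← CStarUltrapower.mk_star, ← CStarUltrapower.mk_mul]
    exact ge_of_tendsto' (h _) fun n => (hσ n).nonneg (a n)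
  map_mul_comm x y := by
    obtain ⟨a, rfl⟩ := CStarUltrapower.mk_surjective x
    obtain ⟨b, rfl⟩ := CStarUltrapower.mk_surjective y
    rw [← CStarUltrapower.mk_mul, ← CStarUltrapower.mk_mul]
    exact tendsto_nhds_unique ((h (a * b)).congr fun n => (hσ n).map_mul_comm (a n) (b n))
      (h (b * a))

theorem le_atTop_of_ne_pure (hU : ∀ n : ℕ, U ≠ pure n) : (U : Filter ℕ) ≤ atTop := by
  rcases U.le_cofinite_or_eq_pure with h | ⟨n, h⟩
  · rwa [Nat.cofinite_eq_atTop] at h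
  · exact absurd h (hU n)

/-- Diagonal argument: sets `S k ∈ U` admit a selection `k n`, tending to infinity along `U`, with
`n ∈ S (k n)` for `U`-almost all `n`. -/
theorem exists_diagonal (hU : (U : Filter ℕ) ≤ atTop) {S : ℕ → Set ℕ} (hS : ∀ k, S k ∈ U) :
    ∃ k : ℕ → ℕ, (∀ᶠ n in U, n ∈ S (k n)) ∧ ∀ K, ∀ᶠ n in U, K ≤ k n := by
  classical
  -- Searching only up to `n` makes the maximum exist. The default `0` is harmless for `n ∈ S 0`,
  -- and `k n ≥ K` once `n ≥ K` and `n ∈ S K`.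
  refine ⟨fun n => Nat.findGreatest (fun k => n ∈ S k) n, ?_, fun K => ?_⟩
  · filter_upwards [hS 0] with n hn
    exact Nat.findGreatest_spec (P := fun k => n ∈ S k) (Nat.zero_le n) hn
  · filter_upwards [hS K, hU (Ici_mem_atTop K)] with n hn hKn
    exact Nat.le_findGreatest hKn hn

/-- The limit, along a free ultrafilter, of the constant ultralimits of the `φ j` is not an
ultralimit, provided the `φ j` are separated from their limit `ψ` on `A`. -/
theorem not_isUltralimit_of_separated (hU : (U : Filter ℕ) ≤ atTop) {V : Ultrafilter ℕ}
    {φ : ℕ → A →L[ℂ] ℂ} {ψ : A →L[ℂ] ℂ} (hψ : ∀ a, Tendsto (fun j => φ j a) V (𝓝 (ψ a)))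
    {Φ : ℕ → CStarUltrapower U A →L[ℂ] ℂ} (hΦ : ∀ j, IsUltralimit U (fun _ => φ j) (Φ j))
    {τ : CStarUltrapower U A →L[ℂ] ℂ} (hτ : ∀ x, Tendsto (fun j => Φ j x) V (𝓝 (τ x)))
    {i : ℕ} (hi : ∀ᶠ j in V, j ≠ i) {α β : ℝ} (hαβ : α < β) {e : ℕ → A}
    (he : ∀ k, ‖e k‖ ≤ 1) (hψe : ∀ k, (ψ (e k)).re ≤ α)
    (hφe : ∀ k j, j ≤ k → j ≠ i → β ≤ (φ j (e k)).re) :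
    (∃ x, β ≤ (τ x).re) ∧ ∀ σ : ℕ → A →L[ℂ] ℂ, ¬ IsUltralimit U σ τ := by
  -- The limit in `n` is taken with `j` fixed, so `j ≤ k n` holds eventually; only then does `j`
  -- vary.
  have hlow : ∀ k : ℕ → ℕ, (∀ K, ∀ᶠ n in U, K ≤ k n) →
      β ≤ (τ (CStarUltrapower.mk U A (boundedSeq (fun n => e (k n)) ⟨1, fun n => he _⟩))).re := by
    intro k hk
    refine ge_of_tendsto ((Complex.continuous_re.tendsto _).comp (hτ _)) ?_
    filter_upwards [hi] with j hj
    refine ge_of_tendsto ((Complex.continuous_re.tendsto _).comp (hΦ j _)) ?_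
    filter_upwards [hk j] with n hn
    exact hφe _ _ hn hj
  refine ⟨⟨_, hlow id fun K => hU (Ici_mem_atTop K)⟩, fun σ hσ => ?_⟩
  have hconst : ∀ a : A, τ (CStarUltrapower.mk U A (boundedSeq (fun _ => a) ⟨_, fun _ => le_rfl⟩)) =
      ψ a := fun a => by
    refine tendsto_nhds_unique (hτ _) ((hψ a).congr fun j => ?_)
    exact tendsto_nhds_unique tendsto_const_nhds
      (hΦ j (boundedSeq (fun _ => a) ⟨_, fun _ => le_rfl⟩))
  -- The gap is needed because the strict bounds on `σ n` pass to the limit only as `≤ γ`.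
  obtain ⟨γ, hαγ, hγβ⟩ := exists_between hαβ
  have hS : ∀ k, {n | (σ n (e k)).re < γ} ∈ U := fun k => by
    have h1 := (Complex.continuous_re.tendsto _).comp
      (hσ (boundedSeq (fun _ => e k) ⟨_, fun _ => le_rfl⟩))
    rw [hconst] at h1
    exact h1.eventually_lt_const ((hψe k).trans_lt hαγ)
  obtain ⟨k, hk1, hk2⟩ := exists_diagonal hU hS
  have hup : (τ (CStarUltrapower.mk U A
      (boundedSeq (fun n => e (k n)) ⟨1, fun n => he _⟩))).re ≤ γ := by
    refine le_of_tendsto ((Complex.continuous_re.tendsto _).comp (hσ _)) ?_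
    filter_upwards [hk1] with n hn
    exact le_of_lt hn
  linarith [hlow k hk2]

end Ultrapower

/-! ### A tracial state that is not an ultralimit of traces -/

theorem mainTheorem2 {A : Type*} [NonUnitalCStarAlgebra A]
    (U : Ultrafilter ℕ) (hU : ∀ n : ℕ, U ≠ pure n)
    (hA : (extremalTracialStates A).Infinite) :
    ∃ τ ∈ tracialStates (CStarUltrapower U A),
      ∀ σ : ℕ → A →L[ℂ] ℂ, (∀ n, IsTrace (σ n)) → ¬ IsUltralimit U σ τ := by
  let _ := CStarAlgebra.spectralOrder A
  have := CStarAlgebra.spectralOrderedRing A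
  have hU' := le_atTop_of_ne_pure hU
  obtain ⟨φ, hinj, hφ⟩ : ∃ φ : ℕ → A →L[ℂ] ℂ, Function.Injective φ ∧
      ∀ j, φ j ∈ extremalTracialStates A :=
    ⟨fun j => hA.natEmbedding _ j, fun _ _ h => (hA.natEmbedding _).injective (Subtype.ext h),
      fun j => (hA.natEmbedding _ j).2⟩
  obtain ⟨ψ, hψ, hψ1⟩ := exists_tendsto_ultrafilter U (f := φ) zero_le_one fun j => (hφ j).1.2.le
  have hψt : IsTrace ψ := .of_tendsto (fun j => (hφ j).1.1) hψ
  choose Φ hΦ hΦ1 using fun j =>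
    exists_isUltralimit U (σ := fun _ => φ j) zero_le_one fun _ => (hφ j).1.2.le
  obtain ⟨τ, hτ, -⟩ := exists_tendsto_ultrafilter U (f := Φ) zero_le_one hΦ1
  have hτt : IsTrace τ := .of_tendsto (fun j => (hΦ j).isTrace fun _ => (hφ j).1.1) hτ
  obtain ⟨i, α, β, e, hα, hαβ, he, hψe, hφe⟩ := exists_separating_limit hφ hinj hψt hψ1
  obtain ⟨⟨x, hx⟩, hnot⟩ := not_isUltralimit_of_separated hU' hψ hΦ hτ
    (hU' (eventually_ne_atTop i)) hαβ he hψe hφe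
  -- Mass could be lost in the limits, so `τ` must be normalized; `β > α ≥ 0` shows it is nonzero.
  have hτ0 : τ ≠ 0 := by
    rintro rfl
    simp only [zero_apply, Complex.zero_re] at hx
    linarith
  refine ⟨‖τ‖⁻¹ • τ, hτt.inv_norm_smul_mem hτ0, fun σ _ hσ => ?_⟩
  -- Rescaling turns an ultralimit representation of the normalized trace into one of `τ`.
  refine hnot (fun n => ‖τ‖ • σ n) fun a => ?_
  have h := (hσ a).const_smul ‖τ‖
  simpa [norm_ne_zero_iff.2 hτ0] using h
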